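/- Let $P=(P_1,\dots,P_n)\colon\mathbb R^m\to\mathbb R^n$ be a map whose components are homogeneous polynomials of degree $2$. Suppose that 1. $P$ is a harmonic morphism: for every open $U\subseteq\mathbb R^n$ and every harmonic $f\colon U\to\mathbb R$, the function $f\circ P\colon P^{-1}(U)\to\mathbb R$ is harmonic; 2. $P$ is umbilic: there is a function $\eta\colon\mathbb R^m\to\mathbb R$ with $dP(x)\bigl(\nabla\|dP\|^2(x)\bigr)=\eta(x)\,P(x)$ for all $x\in\mathbb R^m$, where $\|dP\|^2=\operatorname{Tr}(dP^T dP)$; 3. $P$ is full: $\operatorname{span}\{\nabla\langle P,v\rangle(x)\mid x\in\mathbb R^m,\ v\in\mathbb R^n\}=\mathbb R^m$. Let $V\subseteq\mathbb R^n$ be a linear subspace of dimension $k$, and let $S^{m-1}\subset\mathbb R^m$ be the unit sphere with its induced Riemannian metric. Then $P^{-1}(V)\cap S^{m-1}$ is a closed (that is, compact and without boundary) smooth embedded submanifold of $S^{m-1}$ of codimension $n-k$, possibly empty, and it is minimal in $S^{m-1}$: its mean curvature vector in $S^{m-1}$ vanishes at every point. -/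

import Mathlib

open Set Filter Topology
open scoped ContDiff

noncomputable section

section HarmonicMorphisms

variable {E F : Type*}
  [NormedAddCommGroup E] [InnerProductSpace ℝ E] [FiniteDimensional ℝ E]
  [NormedAddCommGroup F] [InnerProductSpace ℝ F] [FiniteDimensional ℝ F]

/-- A map between Euclidean spaces is a harmonic morphism if it pulls back every (locally defined)
harmonic function to a harmonic function. A function on the open set `U` is represented by
a function on the whole space; only its values on `U` matter. -/
def IsHarmonicMorphism (P : E → F) : Prop :=
  ∀ (U : Set F) (f : F → ℝ), IsOpen U → InnerProductSpace.HarmonicOnNhd f U →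
    InnerProductSpace.HarmonicOnNhd (f ∘ P) (P ⁻¹' U)

/-- The squared Hilbert-Schmidt norm `‖dP‖² (x) = Tr (dP(x)ᵀ dP(x))` of the differential. -/
def diffNormSq (P : E → F) (x : E) : ℝ :=
  LinearMap.trace ℝ E
    ((ContinuousLinearMap.adjoint (fderiv ℝ P x)).comp (fderiv ℝ P x) : E →L[ℝ] E)

/-- `P` is umbilic: there is a function `η` with `dP (∇ ‖dP‖² (x)) = η x • P x` for all `x`. -/
def IsUmbilic (P : E → F) : Prop :=
  ∃ η : E → ℝ, ∀ x, fderiv ℝ P x (gradient (diffNormSq P) x) = η x • P x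

/-- `P` is full: the gradients of all the functions `⟨P, v⟩`, at all points, span the domain. -/
def IsFullMap (P : E → F) : Prop :=
  Submodule.span ℝ {w : E | ∃ (x : E) (v : F), w = gradient (fun y => inner ℝ (P y) v) x} = ⊤

end HarmonicMorphisms

/-- `P : ℝᵐ → ℝⁿ` is quadratic: each of its components is a homogeneous polynomial of degree 2. -/
def IsQuadraticMap {m n : ℕ} (P : EuclideanSpace ℝ (Fin m) → EuclideanSpace ℝ (Fin n)) : Prop :=
  ∃ p : Fin n → MvPolynomial (Fin m) ℝ, (∀ i, (p i).IsHomogeneous 2) ∧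
    ∀ x i, P x i = MvPolynomial.eval (fun j => x j) (p i)

section Submanifolds

variable {E : Type*} [NormedAddCommGroup E] [InnerProductSpace ℝ E] [FiniteDimensional ℝ E]

/-- `M` is a smooth embedded submanifold (without boundary) of codimension `c` of the submanifold
`N` of the Euclidean space `E`: `M ⊆ N`, and near each point of `M` there is a smooth
coordinate system of `E` in which `N` is an open piece of a linear subspace `K`, and `M` is
the corresponding piece of a linear subspace `L ≤ K` of codimension `c` in `K`.
The empty set is a submanifold of every codimension. -/
def IsSubmanifoldOfCodim (M N : Set E) (c : ℕ) : Prop :=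
  M ⊆ N ∧ ∀ x ∈ M, ∃ (Φ : OpenPartialHomeomorph E E) (L K : Submodule ℝ E),
    x ∈ Φ.source ∧ ContDiffOn ℝ ∞ Φ Φ.source ∧ ContDiffOn ℝ ∞ Φ.symm Φ.target ∧
    L ≤ K ∧ Module.finrank ℝ L + c = Module.finrank ℝ K ∧
    Φ '' (Φ.source ∩ N) = Φ.target ∩ K ∧ Φ '' (Φ.source ∩ M) = Φ.target ∩ L

/-- The tangent space `T_x M ⊆ E`: spanned by the velocities at `x` of the smooth
curves in `M` through `x` (for a submanifold these velocities already form a subspace). -/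
def tangentSpaceAt (M : Set E) (x : E) : Submodule ℝ E :=
  Submodule.span ℝ {v : E | ∃ γ : ℝ → E, (∀ᶠ t in 𝓝 (0 : ℝ), ContDiffAt ℝ ∞ γ t ∧ γ t ∈ M) ∧
    γ 0 = x ∧ deriv γ 0 = v}

/-- The normal space at `x` of `M` in `N`: the orthogonal complement of `T_x M` in `T_x N`. -/
def normalSpaceAt (M N : Set E) (x : E) : Submodule ℝ E :=
  (tangentSpaceAt M x)ᗮ ⊓ tangentSpaceAt N x

/-- A smooth vector field tangent to `M` on a neighbourhood of `x` in `M`, given by a smooth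
extension to a neighbourhood of `x` in `E`. -/
def IsTangentFieldNear (M : Set E) (x : E) (Y : E → E) : Prop :=
  (∀ᶠ y in 𝓝 x, ContDiffAt ℝ ∞ Y y) ∧ ∀ᶠ y in 𝓝[M] x, Y y ∈ tangentSpaceAt M y

/-- The Levi-Civita connection `(∇_X Y)(x)` of the metric induced on `N` by `E`: the projection
to `T_x N` of the derivative of `Y` in the direction `X x`. -/
def leviCivita (N : Set E) (X Y : E → E) (x : E) : E :=
  (tangentSpaceAt N x).starProjection (fderiv ℝ Y x (X x))

/-- `H` is the mean curvature vector at `x` of the submanifold `M` of `N`: the trace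
`∑ i, II (e i, e i)` of the second fundamental form `II (X, Y) = (∇_X Y)^⊥` of `M` in `N` over an
orthonormal basis of `T_x M`, whose members are extended to tangent fields of `M` near `x`. -/
def IsMeanCurvatureVectorAt (M N : Set E) (x H : E) : Prop :=
  ∃ (d : ℕ) (e : Fin d → E → E), (∀ i, IsTangentFieldNear M x (e i)) ∧
    Orthonormal ℝ (fun i => e i x) ∧
    Submodule.span ℝ (range fun i => e i x) = tangentSpaceAt M x ∧
    H = ∑ i, (normalSpaceAt M N x).starProjection (leviCivita N (e i) (e i) x)

/-- The submanifold `M` of `N` is minimal: at each of its points the mean curvature vector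
(is well defined and) vanishes. -/
def IsMinimalIn (M N : Set E) : Prop :=
  ∀ x ∈ M, ∀ H : E, IsMeanCurvatureVectorAt M N x H ↔ H = 0

end Submanifolds

end

open scoped RealInnerProductSpace InnerProductSpace Laplacian

/-! Write `⟨P x, v⟩ = ⟨A v x, x⟩` with `A v` symmetric and linear in `v`. Pulling back linear
functions gives `tr (A v) = 0`; pulling back products of two orthogonal linear functions gives `⟨A v
x, A w x⟩ = 0` for `v ⊥ w`. By polarization, `A v` and `A w` anticommute for `v ⊥ w`, and `(A v)² =
(A w)²` for `‖v‖ = ‖w‖`. Hence `∇‖dP‖²` is a multiple of `(A v)² x`, and umbilicity forces `⟨A v x,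
(A v)² x⟩ = 0` wherever `⟨P x, v⟩ = 0`, for unit `v`. Fullness gives `A v x ≠ 0` for `x ≠ 0`.

With `v j` an orthonormal basis of `Vᗮ`, the set is the common zero locus of `‖x‖² - 1` and the `⟨A
(v j) x, x⟩`, whose gradients there are orthogonal and nonzero; this gives the submanifold. Up to
sign and scale, its mean curvature along `A (v j) x` is the trace of `A (v j)` over the tangent
space. The full trace is zero, and so is each contribution from the normal directions `x` and `A (v
l) x` (`inner_apply_apply_apply_eq_zero`), so the tangential trace vanishes. -/

theorem exists_isSymmetric_of_isHomogeneous_two {m : ℕ} {p : MvPolynomial (Fin m) ℝ}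
    (hp : p.IsHomogeneous 2) :
    ∃ T : EuclideanSpace ℝ (Fin m) →L[ℝ] EuclideanSpace ℝ (Fin m),
      (∀ x y, ⟪T x, y⟫_ℝ = ⟪x, T y⟫_ℝ) ∧
      ∀ x : EuclideanSpace ℝ (Fin m), MvPolynomial.eval (fun j => x j) p = ⟪T x, x⟫_ℝ := by
  classical
  -- Half the Hessian of `p`, whose entries are constants; Euler's identity in degree 2 and then in
  -- degree 1 recovers `p` from it.
  set H : Matrix (Fin m) (Fin m) ℝ := Matrix.of fun j k =>
    2⁻¹ * MvPolynomial.coeff 0 (MvPolynomial.pderiv k (MvPolynomial.pderiv j p)) with hH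
  have hsymm : H.IsHermitian := by
    ext j k
    simp only [hH, Matrix.conjTranspose_apply, Matrix.of_apply, star_trivial]
    congr 2
    have h : ⁅MvPolynomial.pderiv (R := ℝ) j, MvPolynomial.pderiv k⁆ = 0 :=
      MvPolynomial.derivation_ext fun i => by
        rw [Derivation.commutator_apply, MvPolynomial.pderiv_X, MvPolynomial.pderiv_X]
        simp only [Pi.single_apply]
        split_ifs <;> simp
    have h' := congrArg (fun D => D p) h
    rw [Derivation.commutator_apply] at h'
    exact sub_eq_zero.1 h'
  refine ⟨LinearMap.toContinuousLinearMap (Matrix.toEuclideanLin H), fun x y => ?_, fun x => ?_⟩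
  · exact Matrix.isSymmetric_toEuclideanLin_iff.2 hsymm x y
  · have h1 := congrArg (MvPolynomial.eval (fun j => x j)) hp.sum_X_mul_pderiv
    have h2 : ∀ j, ∑ k, x k * (2 * H j k) =
        MvPolynomial.eval (fun j => x j) (MvPolynomial.pderiv j p) := by
      intro j
      have hj : (MvPolynomial.pderiv j p).IsHomogeneous 1 := hp.pderiv
      have h3 := congrArg (MvPolynomial.eval (fun j => x j)) hj.sum_X_mul_pderiv
      simp only [map_sum, map_mul, MvPolynomial.eval_X, one_smul] at h3
      rw [← h3]
      refine Finset.sum_congr rfl fun k _ => ?_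
      have h0 : (MvPolynomial.pderiv k (MvPolynomial.pderiv j p)).IsHomogeneous 0 := hj.pderiv
      rw [← MvPolynomial.totalDegree_zero_iff_isHomogeneous,
        MvPolynomial.totalDegree_eq_zero_iff_eq_C] at h0
      conv_rhs => rw [h0]
      simp [hH]
    simp only [map_sum, map_mul, MvPolynomial.eval_X, map_nsmul, ← h2] at h1
    simp only [LinearMap.coe_toContinuousLinearMap', PiLp.inner_apply, Matrix.toLpLin_apply,
      Matrix.mulVec, dotProduct, RCLike.inner_apply, conj_trivial]
    simp only [nsmul_eq_mul] at h1
    have : ∑ j, x j * ∑ k, x k * (2 * H j k) = 2 * ∑ j, x j * ∑ k, H j k * x k := by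
      simp only [Finset.mul_sum]
      refine Finset.sum_congr rfl fun j _ => Finset.sum_congr rfl fun k _ => by ring
    rw [this] at h1
    push_cast at h1
    linarith

theorem IsQuadraticMap.exists_inner_eq {m n : ℕ}
    {P : EuclideanSpace ℝ (Fin m) → EuclideanSpace ℝ (Fin n)} (hP : IsQuadraticMap P) :
    ∃ A : EuclideanSpace ℝ (Fin n) →ₗ[ℝ]
        EuclideanSpace ℝ (Fin m) →L[ℝ] EuclideanSpace ℝ (Fin m),
      (∀ v x y, ⟪A v x, y⟫_ℝ = ⟪x, A v y⟫_ℝ) ∧ ∀ x v, ⟪P x, v⟫_ℝ = ⟪A v x, x⟫_ℝ := by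
  obtain ⟨p, hp, hPp⟩ := hP
  choose T hT hTp using fun i => exists_isSymmetric_of_isHomogeneous_two (hp i)
  refine ⟨∑ i, (EuclideanSpace.proj (𝕜 := ℝ) i).toLinearMap.smulRight (T i),
    fun v x y => ?_, fun x v => ?_⟩
  · simp [sum_inner, inner_sum, inner_smul_left, inner_smul_right, hT]
  · simp [sum_inner, inner_smul_left, PiLp.inner_apply, hPp, hTp]

/-! ### Laplacians of linear and quadratic functions -/

section Laplacian

variable {E F : Type*} [NormedAddCommGroup E] [InnerProductSpace ℝ E]
  [NormedAddCommGroup F] [InnerProductSpace ℝ F]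

theorem hasFDerivAt_inner_self {A : E →L[ℝ] E} (hA : ∀ x y, ⟪A x, y⟫_ℝ = ⟪x, A y⟫_ℝ)
    (x : E) :
    HasFDerivAt (fun y => ⟪A y, y⟫_ℝ) ((2 : ℝ) • innerSL ℝ (A x)) x := by
  refine (A.hasFDerivAt.inner ℝ (hasFDerivAt_id x)).congr_fderiv ?_
  ext y
  simp [hA, two_mul]
  rw [real_inner_comm, hA]

variable [FiniteDimensional ℝ E]

theorem laplacian_mul {f g : E → ℝ} (hf : ContDiff ℝ 2 f) (hg : ContDiff ℝ 2 g)
    {ι : Type*} [Fintype ι] (b : OrthonormalBasis ι ℝ E) (x : E) :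
    (Δ (fun y => f y * g y)) x =
      f x * (Δ g) x + g x * (Δ f) x + 2 * ∑ i, fderiv ℝ f x (b i) * fderiv ℝ g x (b i) := by
  have hf1 := hf.differentiable (by norm_num)
  have hg1 := hg.differentiable (by norm_num)
  have hf2 : Differentiable ℝ (fderiv ℝ f) :=
    (hf.fderiv_right (m := 1) (by norm_num)).differentiable (by norm_num)
  have hg2 : Differentiable ℝ (fderiv ℝ g) :=
    (hg.fderiv_right (m := 1) (by norm_num)).differentiable (by norm_num)
  have h1 : fderiv ℝ (fun y => f y * g y) = fun y => f y • fderiv ℝ g y + g y • fderiv ℝ f y :=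
    funext fun y => fderiv_fun_mul (hf1 y) (hg1 y)
  simp only [InnerProductSpace.laplacian_eq_iteratedFDeriv_orthonormalBasis _ b,
    iteratedFDeriv_two_apply, h1]
  rw [fderiv_fun_add ((hf1 x).fun_smul (hg2 x)) ((hg1 x).fun_smul (hf2 x)), fderiv_fun_smul (hf1 x) (hg2 x),
    fderiv_fun_smul (hg1 x) (hf2 x)]
  simp only [Finset.mul_sum, ← Finset.sum_add_distrib]
  refine Finset.sum_congr rfl fun i _ => ?_
  simp
  ring

theorem laplacian_clm (l : E →L[ℝ] ℝ) : Δ (fun x => l x) = 0 := by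
  ext x
  have : fderiv ℝ (fun x => l x) = fun _ => l := funext fun y => l.fderiv
  simp [InnerProductSpace.laplacian_eq_iteratedFDeriv_stdOrthonormalBasis,
    iteratedFDeriv_two_apply, this]

theorem fderiv_inner_const_right (v y : F) :
    fderiv ℝ (fun y => ⟪y, v⟫_ℝ) y = innerSL ℝ v := by
  have h : (fun y : F => ⟪y, v⟫_ℝ) = fun y => innerSL ℝ v y := by
    ext y; simp [real_inner_comm]
  rw [h]
  exact (innerSL ℝ v).fderiv

variable [FiniteDimensional ℝ F]

theorem laplacian_inner_const_right (v : F) : (Δ fun y : F => ⟪y, v⟫_ℝ) = 0 := by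
  have h : (fun y : F => ⟪y, v⟫_ℝ) = fun y => innerSL ℝ v y := by
    ext y; simp [real_inner_comm]
  rw [h, laplacian_clm]

theorem harmonicOnNhd_inner (v : F) (s : Set F) :
    InnerProductSpace.HarmonicOnNhd (fun y => ⟪y, v⟫_ℝ) s := fun _ _ =>
  ⟨contDiffAt_id.inner ℝ contDiffAt_const, by rw [laplacian_inner_const_right]⟩

/-- The Laplacian of this product is `2⟨v, w⟩`. These quadratics, together with the linear
functions, are the only test functions needed from the harmonic morphism property. -/
theorem harmonicOnNhd_inner_mul_inner {v w : F} (hvw : ⟪v, w⟫_ℝ = 0) (s : Set F) :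
    InnerProductSpace.HarmonicOnNhd (fun y => ⟪y, v⟫_ℝ * ⟪y, w⟫_ℝ) s := by
  have h : ∀ v : F, ContDiff ℝ 2 fun y : F => ⟪y, v⟫_ℝ := fun v =>
    contDiff_id.inner ℝ contDiff_const
  refine fun x _ => ⟨((h v).mul (h w)).contDiffAt, Eventually.of_forall fun y => ?_⟩
  rw [laplacian_mul (h v) (h w) (stdOrthonormalBasis ℝ F)]
  have := (stdOrthonormalBasis ℝ F).sum_inner_mul_inner v w
  simp only [fderiv_inner_const_right, laplacian_inner_const_right]
  simpa [hvw, real_inner_comm] using this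

theorem laplacian_inner_self {A : E →L[ℝ] E} (hA : ∀ x y, ⟪A x, y⟫_ℝ = ⟪x, A y⟫_ℝ)
    (x : E) :
    (Δ fun y => ⟪A y, y⟫_ℝ) x = 2 * LinearMap.trace ℝ E A := by
  have h : fderiv ℝ (fun y => ⟪A y, y⟫_ℝ) = fun y => ((2 : ℝ) • (innerSL ℝ).comp A) y :=
    funext fun y => (hasFDerivAt_inner_self hA y).fderiv
  rw [LinearMap.trace_eq_sum_inner _ (stdOrthonormalBasis ℝ E)]
  simp only [InnerProductSpace.laplacian_eq_iteratedFDeriv_stdOrthonormalBasis,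
    iteratedFDeriv_two_apply, h, Finset.mul_sum]
  exact Finset.sum_congr rfl fun i _ => by
    rw [ContinuousLinearMap.fderiv]; simp [real_inner_comm]

end Laplacian

/-! ### Level sets with orthogonal gradients: charts and tangent spaces -/

section LevelSets

variable {E : Type*} [NormedAddCommGroup E] [InnerProductSpace ℝ E]
  {ι : Type*}

theorem mem_orthogonal_span_image_iff {a : ι → E} {s : Set ι} {w : E} :
    w ∈ (Submodule.span ℝ (a '' s))ᗮ ↔ ∀ i ∈ s, ⟪a i, w⟫_ℝ = 0 := by
  refine ⟨fun h i hi => h _ (Submodule.subset_span (mem_image_of_mem a hi)), fun h u hu => ?_⟩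
  induction hu using Submodule.span_induction with
  | mem u hu => obtain ⟨i, hi, rfl⟩ := hu; exact h i hi
  | zero => simp
  | add u v _ _ hu hv => rw [inner_add_left, hu, hv, add_zero]
  | smul c u _ hu => rw [inner_smul_left, hu, mul_zero]

/-- The functions `g i` have gradients `a i`, which are orthogonal and nonzero on the common
zero set. -/
structure IsOrthogonalSystem (g : ι → E → ℝ) (a : ι → E → E) : Prop where
  contDiff : ∀ i, ContDiff ℝ ∞ (g i)
  contDiff_gradient : ∀ i, ContDiff ℝ ∞ (a i)
  hasFDerivAt : ∀ i y, HasFDerivAt (g i) (innerSL ℝ (a i y)) y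
  inner_eq_zero : ∀ y, (∀ i, g i y = 0) → Pairwise fun i j => ⟪a i y, a j y⟫_ℝ = 0
  ne_zero : ∀ y, (∀ i, g i y = 0) → ∀ i, a i y ≠ 0

namespace IsOrthogonalSystem

variable {g : ι → E → ℝ} {a : ι → E → E}

theorem linearIndependent (h : IsOrthogonalSystem g a) {x : E} (hx : ∀ i, g i x = 0) :
    LinearIndependent ℝ fun i => a i x :=
  linearIndependent_of_ne_zero_of_inner_eq_zero (h.ne_zero x hx) (h.inner_eq_zero x hx)

end IsOrthogonalSystem

theorem apply_eq_zero_of_mem_tangentSpaceAt {M : Set E} {x w : E} {f : E → ℝ} {f' : E →L[ℝ] ℝ}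
    (hf : HasFDerivAt f f' x) (h0 : ∀ᶠ y in 𝓝[M] x, f y = 0) (hw : w ∈ tangentSpaceAt M x) :
    f' w = 0 := by
  suffices h : tangentSpaceAt M x ≤ LinearMap.ker f'.toLinearMap from h hw
  refine Submodule.span_le.2 ?_
  rintro v ⟨γ, hγ, rfl, rfl⟩
  have h1 : HasDerivAt γ (deriv γ 0) 0 :=
    (hγ.self_of_nhds.1.differentiableAt (by simp)).hasDerivAt
  have h2 : Tendsto γ (𝓝 0) (𝓝[M] γ 0) :=
    tendsto_nhdsWithin_iff.2 ⟨h1.continuousAt, hγ.mono fun t ht => ht.2⟩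
  have h3 : f ∘ γ =ᶠ[𝓝 0] fun _ => (0 : ℝ) := h2 h0
  exact (h3.hasDerivAt_iff.1 (hf.comp_hasDerivAt (0 : ℝ) h1)).unique
    (hasDerivAt_const (0 : ℝ) (0 : ℝ))

variable [FiniteDimensional ℝ E]

/-- Restricting a smooth local homeomorphism to the points where its derivative is invertible
makes its inverse smooth. -/
theorem exists_openPartialHomeomorph_of_hasFDerivAt {Ψ : E → E} (hΨ : ContDiff ℝ ∞ Ψ) {x : E}
    {D : E ≃L[ℝ] E} (hD : HasFDerivAt Ψ (D : E →L[ℝ] E) x) :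
    ∃ Φ : OpenPartialHomeomorph E E, (∀ y, Φ y = Ψ y) ∧ x ∈ Φ.source ∧
      ContDiffOn ℝ ∞ Φ.symm Φ.target := by
  have hopen : IsOpen {y | fderiv ℝ Ψ y ∈ range ((↑) : (E ≃L[ℝ] E) → E →L[ℝ] E)} :=
    ContinuousLinearEquiv.isOpen.preimage (hΨ.continuous_fderiv (by simp))
  refine ⟨(hΨ.contDiffAt.toOpenPartialHomeomorph Ψ hD (by simp)).restrOpen _ hopen,
    fun y => rfl, ⟨hΨ.contDiffAt.mem_toOpenPartialHomeomorph_source hD (by simp), D, ?_⟩,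
    fun z hz => ?_⟩
  · exact hD.fderiv.symm
  · set Φ := (hΨ.contDiffAt.toOpenPartialHomeomorph Ψ hD (by simp)).restrOpen _ hopen
    obtain ⟨-, D', hD'⟩ := Φ.map_target hz
    refine (Φ.contDiffAt_symm hz (f₀' := D') ?_ hΨ.contDiffAt).contDiffWithinAt
    rw [hD']
    exact (hΨ.differentiable (by simp) _).hasFDerivAt

/-- The chart is `y ↦ proj_T y + ∑ g j y • a j`, where `T` is the orthogonal complement of the
gradients at `x`. Pairing with `a i` isolates `g i`, so vanishing of `g i` becomes orthogonality to
`a i`. -/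
theorem exists_adapted_chart [Fintype ι] {g : ι → E → ℝ} (hg : ∀ i, ContDiff ℝ ∞ (g i))
    {a : ι → E} {x : E} (ha : ∀ i, HasFDerivAt (g i) (innerSL ℝ (a i)) x)
    (horth : Pairwise fun i j => ⟪a i, a j⟫_ℝ = 0) (hne : ∀ i, a i ≠ 0) :
    ∃ (Φ : OpenPartialHomeomorph E E) (D : E ≃L[ℝ] E), x ∈ Φ.source ∧ ContDiff ℝ ∞ Φ ∧
      ContDiffOn ℝ ∞ Φ.symm Φ.target ∧ (∀ i y, ⟪a i, Φ y⟫_ℝ = ‖a i‖ ^ 2 * g i y) ∧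
      HasFDerivAt Φ (D : E →L[ℝ] E) x ∧ ∀ i w, ⟪a i, D w⟫_ℝ = ‖a i‖ ^ 2 * ⟪a i, w⟫_ℝ := by
  classical
  set T := (Submodule.span ℝ (a '' univ))ᗮ with hT
  have hsum : ∀ (c : ι → ℝ) (w : E) i,
      ⟪a i, T.starProjection w + ∑ j, c j • a j⟫_ℝ = ‖a i‖ ^ 2 * c i := by
    intro c w i
    rw [inner_add_right,
      mem_orthogonal_span_image_iff.1 (T.starProjection_apply_mem w) i (mem_univ i), inner_sum,
      Finset.sum_eq_single i (fun j _ hj => by rw [inner_smul_right, horth hj.symm, mul_zero])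
        (by simp), inner_smul_right, real_inner_self_eq_norm_sq]
    ring
  set Ψ : E → E := fun y => T.starProjection y + ∑ j, g j y • a j
  set D₀ : E →L[ℝ] E := T.starProjection + ∑ j, (innerSL ℝ (a j)).smulRight (a j) with hD₀
  have hD₀w : ∀ w, D₀ w = T.starProjection w + ∑ j, ⟪a j, w⟫_ℝ • a j := fun w => by simp [hD₀]
  have hΨ : ContDiff ℝ ∞ Ψ := by
    have := fun j => (hg j).smul (contDiff_const (c := a j))
    exact T.starProjection.contDiff.add (ContDiff.sum fun j _ => this j)
  have hΨD : HasFDerivAt Ψ D₀ x :=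
    T.starProjection.hasFDerivAt.add (HasFDerivAt.fun_sum fun j _ => (ha j).smul_const (a j))
  have hinj : Function.Injective D₀ := by
    refine (injective_iff_map_eq_zero D₀).2 fun w hw => ?_
    have h1 : ∀ i, ⟪a i, w⟫_ℝ = 0 := fun i => by
      have := hsum (fun j => ⟪a j, w⟫_ℝ) w i
      rw [← hD₀w, hw, inner_zero_right] at this
      simpa [hne i] using this.symm
    have h2 : w ∈ T := mem_orthogonal_span_image_iff.2 fun i _ => h1 i
    simpa [hD₀w, h1, Submodule.starProjection_eq_self_iff.2 h2] using hw
  set D : E ≃L[ℝ] E := (LinearEquiv.ofInjectiveEndo D₀.toLinearMap hinj).toContinuousLinearEquiv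
  have hD : (D : E →L[ℝ] E) = D₀ := rfl
  obtain ⟨Φ, hΦ, hx, hsymm⟩ := exists_openPartialHomeomorph_of_hasFDerivAt hΨ (hD ▸ hΨD)
  have hΦΨ : (Φ : E → E) = Ψ := funext hΦ
  refine ⟨Φ, D, hx, hΦΨ ▸ hΨ, hsymm, fun i y => ?_, hΦΨ ▸ hΨD, fun i w => ?_⟩
  · rw [hΦ]; exact hsum _ _ _
  · exact (congrArg _ (hD₀w w)).trans (hsum _ _ _)

/-- A vector orthogonal to the gradients in `s` is the velocity of a straight line in the adapted
chart, pulled back. Allowing any `s` treats the ambient submanifold and the smaller one together. -/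
theorem tangentSpaceAt_levelSet [Fintype ι] {g : ι → E → ℝ} (hg : ∀ i, ContDiff ℝ ∞ (g i))
    {a : ι → E} {x : E} (ha : ∀ i, HasFDerivAt (g i) (innerSL ℝ (a i)) x)
    (horth : Pairwise fun i j => ⟪a i, a j⟫_ℝ = 0) (hne : ∀ i, a i ≠ 0) {s : Set ι}
    (hx : ∀ i ∈ s, g i x = 0) :
    tangentSpaceAt {y | ∀ i ∈ s, g i y = 0} x = (Submodule.span ℝ (a '' s))ᗮ := by
  refine le_antisymm (fun w hw => ?_) fun w hw => Submodule.subset_span ?_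
  · refine mem_orthogonal_span_image_iff.2 fun i hi => ?_
    simpa using apply_eq_zero_of_mem_tangentSpaceAt (M := {y | ∀ i ∈ s, g i y = 0}) (ha i)
      (eventually_nhdsWithin_of_forall fun y hy => hy i hi) hw
  · obtain ⟨Φ, D, hxΦ, hΦ, hΦs, hΦg, hΦD, hD⟩ := exists_adapted_chart hg ha horth hne
    rw [mem_orthogonal_span_image_iff] at hw
    set c : ℝ → E := fun t => Φ x + t • D w
    have hc : ContDiff ℝ ∞ c := contDiff_const.add (contDiff_id.smul contDiff_const)
    have hc0 : c 0 = Φ x := by simp [c]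
    have hmem : ∀ᶠ t in 𝓝 (0 : ℝ), c t ∈ Φ.target :=
      hc.continuous.continuousAt (Φ.open_target.mem_nhds (hc0 ▸ Φ.map_source hxΦ))
    refine ⟨fun t => Φ.symm (c t), hmem.mono fun t ht => ⟨?_, fun i hi => ?_⟩, ?_, ?_⟩
    · exact (hΦs.contDiffAt (Φ.open_target.mem_nhds ht)).comp t hc.contDiffAt
    · have := hΦg i (Φ.symm (c t))
      rw [Φ.right_inv ht, inner_add_right, hΦg, inner_smul_right, hD, hw i hi, hx i hi] at this
      simpa [hne i] using this.symm
    · simp [hc0, Φ.left_inv hxΦ]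
    · have h1 : HasFDerivAt Φ.symm (D.symm : E →L[ℝ] E) (c 0) := by
        rw [hc0]
        refine Φ.hasFDerivAt_symm (Φ.map_source hxΦ) ?_
        rwa [Φ.left_inv hxΦ]
      have h2 : HasDerivAt c (D w) 0 := by
        simpa [c] using ((hasDerivAt_id (0 : ℝ)).smul_const (D w)).const_add (Φ x)
      simpa [Function.comp_def] using (h1.comp_hasDerivAt (0 : ℝ) h2).deriv

namespace IsOrthogonalSystem

variable [Fintype ι] {g : ι → E → ℝ} {a : ι → E → E}

theorem tangentSpaceAt_eq (h : IsOrthogonalSystem g a) (s : Set ι) {x : E}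
    (hx : ∀ i, g i x = 0) :
    tangentSpaceAt {y | ∀ i ∈ s, g i y = 0} x = (Submodule.span ℝ ((a · x) '' s))ᗮ :=
  tangentSpaceAt_levelSet h.contDiff (h.hasFDerivAt · x) (h.inner_eq_zero x hx) (h.ne_zero x hx)
    fun i _ => hx i

theorem tangentSpaceAt_eq' (h : IsOrthogonalSystem g a) {x : E} (hx : ∀ i, g i x = 0) :
    tangentSpaceAt {y | ∀ i, g i y = 0} x = (Submodule.span ℝ (range (a · x)))ᗮ := by
  simpa using h.tangentSpaceAt_eq univ hx

theorem mem_tangentSpaceAt_iff (h : IsOrthogonalSystem g a) {x w : E} (hx : ∀ i, g i x = 0) :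
    w ∈ tangentSpaceAt {y | ∀ i, g i y = 0} x ↔ ∀ i, ⟪a i x, w⟫_ℝ = 0 := by
  rw [h.tangentSpaceAt_eq' hx, ← image_univ, mem_orthogonal_span_image_iff]
  simp

theorem isSubmanifoldOfCodim (h : IsOrthogonalSystem g a) (s : Finset ι) :
    IsSubmanifoldOfCodim {y | ∀ i, g i y = 0} {y | ∀ i ∈ s, g i y = 0}
      (Fintype.card ι - s.card) := by
  classical
  refine ⟨fun y hy i _ => hy i, fun x hx => ?_⟩
  obtain ⟨Φ, D, hxΦ, hΦ, hΦs, hΦg, -, -⟩ := exists_adapted_chart h.contDiff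
    (h.hasFDerivAt · x) (h.inner_eq_zero x hx) (h.ne_zero x hx)
  -- One chart flattens the zero sets of all subfamilies at once; it is used for `s` and for the
  -- whole family.
  have key : ∀ t : Finset ι, Φ '' (Φ.source ∩ {y | ∀ i ∈ t, g i y = 0}) =
      Φ.target ∩ ((Submodule.span ℝ ((a · x) '' (t : Set ι)))ᗮ : Submodule ℝ E) := by
    intro t
    have hiff : ∀ y, Φ y ∈ (Submodule.span ℝ ((a · x) '' (t : Set ι)))ᗮ ↔
        ∀ i ∈ t, g i y = 0 := fun y => by
      simp only [mem_orthogonal_span_image_iff, hΦg]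
      exact forall₂_congr fun i _ => by simp [h.ne_zero x hx i]
    ext z
    constructor
    · rintro ⟨y, ⟨hy, hyt⟩, rfl⟩
      exact ⟨Φ.map_source hy, (hiff y).2 hyt⟩
    · rintro ⟨hz, hzt⟩
      refine ⟨Φ.symm z, ⟨Φ.map_target hz, (hiff _).1 ?_⟩, Φ.right_inv hz⟩
      rwa [Φ.right_inv hz]
  have hrank : ∀ t : Finset ι, t.card +
      Module.finrank ℝ (Submodule.span ℝ ((a · x) '' (t : Set ι)))ᗮ = Module.finrank ℝ E := by
    intro t
    rw [← Submodule.finrank_add_finrank_orthogonal (Submodule.span ℝ ((a · x) '' (t : Set ι))),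
      ← Finset.coe_image, finrank_span_finset_eq_card,
      Finset.card_image_of_injective _ (h.linearIndependent hx).injective]
    rw [Finset.coe_image]
    exact ((h.linearIndependent hx).linearIndepOn t).id_image
  refine ⟨Φ, (Submodule.span ℝ ((a · x) '' ((Finset.univ : Finset ι) : Set ι)))ᗮ,
    (Submodule.span ℝ ((a · x) '' (s : Set ι)))ᗮ, hxΦ, hΦ.contDiffOn, hΦs,
    Submodule.orthogonal_le (Submodule.span_mono (image_mono (by simp))), ?_, key s, ?_⟩
  · have h1 := hrank s
    have h2 := hrank Finset.univ
    have h3 := s.card_le_univ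
    rw [Finset.card_univ] at h2
    omega
  · simpa using key Finset.univ

end IsOrthogonalSystem

end LevelSets

/-! ### Mean curvature of level sets -/

section MeanCurvature

variable {E : Type*} [NormedAddCommGroup E] [InnerProductSpace ℝ E]
  {ι : Type*} [Fintype ι]

theorem OrthonormalBasis.span_range_coe {T : Submodule ℝ E} (b : OrthonormalBasis ι ℝ T) :
    Submodule.span ℝ (range fun i => (b i : E)) = T := by
  have := congrArg (Submodule.map (Submodule.subtype _)) b.toBasis.span_eq
  rw [Submodule.map_span, ← range_comp, Submodule.map_top, Submodule.range_subtype] at this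
  simpa [Function.comp_def] using this

variable [FiniteDimensional ℝ E]

theorem trace_eq_sum_inner_add_sum_inner {d : ℕ} {e : Fin d → E} (he : Orthonormal ℝ e)
    {a : ι → E} (horth : Pairwise fun i j => ⟪a i, a j⟫_ℝ = 0) (hne : ∀ i, a i ≠ 0)
    (hspan : Submodule.span ℝ (range e) = (Submodule.span ℝ (range a))ᗮ) (T : E →L[ℝ] E) :
    LinearMap.trace ℝ E T =
      ∑ k, ⟪T (e k), e k⟫_ℝ + ∑ i, ⟪T (a i), a i⟫_ℝ / ‖a i‖ ^ 2 := by
  have hea : ∀ k i, ⟪e k, a i⟫_ℝ = 0 := fun k i => by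
    have : e k ∈ (Submodule.span ℝ (range a))ᗮ :=
      hspan ▸ Submodule.subset_span (mem_range_self k)
    rw [real_inner_comm]
    exact this _ (Submodule.subset_span (mem_range_self i))
  have hne' : ∀ i, ‖a i‖ ≠ 0 := fun i => norm_ne_zero_iff.2 (hne i)
  have hon : Orthonormal ℝ (Sum.elim e fun i => ‖a i‖⁻¹ • a i) := by
    refine ⟨?_, ?_⟩
    · rintro (k | i)
      · exact he.1 k
      · simp [norm_smul, hne' i]
    · rintro (k | i) (l | j) hij
      · exact he.2 fun h => hij (h ▸ rfl)
      · simp [inner_smul_right, hea]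
      · simp [inner_smul_left, real_inner_comm, hea]
      · have : i ≠ j := fun h => hij (h ▸ rfl)
        simp [inner_smul_left, inner_smul_right, horth this]
  have htop : ⊤ ≤ Submodule.span ℝ (range (Sum.elim e fun i => ‖a i‖⁻¹ • a i)) := by
    rw [Sum.elim_range, Submodule.span_union, hspan,
      ← Submodule.sup_orthogonal_of_hasOrthogonalProjection (K := Submodule.span ℝ (range a)),
      sup_comm]
    refine sup_le_sup_left (Submodule.span_le.2 ?_) _
    rintro _ ⟨i, rfl⟩
    have : a i = ‖a i‖ • ‖a i‖⁻¹ • a i := by rw [smul_smul, mul_inv_cancel₀ (hne' i), one_smul]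
    rw [SetLike.mem_coe, this]
    exact Submodule.smul_mem _ _ (Submodule.subset_span (mem_range_self i))
  rw [LinearMap.trace_eq_sum_inner _ (OrthonormalBasis.mk hon htop)]
  simp only [OrthonormalBasis.coe_mk, Fintype.sum_sum_type, Sum.elim_inl, Sum.elim_inr]
  congr 1
  · exact Finset.sum_congr rfl fun k _ => real_inner_comm _ _
  · refine Finset.sum_congr rfl fun i _ => ?_
    simp only [ContinuousLinearMap.coe_coe, map_smul, inner_smul_left, inner_smul_right,
      conj_trivial]
    rw [real_inner_comm]
    field_simp

namespace IsOrthogonalSystem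

variable {g : ι → E → ℝ} {a : ι → E → E}

/-- Differentiate `⟨Y, a i⟩ = 0` along the level set in the tangent direction `Y x`: the second
fundamental form is minus the Hessian of `g i`. -/
theorem inner_fderiv_of_isTangentFieldNear (h : IsOrthogonalSystem g a) {x : E}
    (hx : ∀ i, g i x = 0) {Y : E → E} (hY : IsTangentFieldNear {y | ∀ i, g i y = 0} x Y) (i : ι) :
    ⟪fderiv ℝ Y x (Y x), a i x⟫_ℝ = -⟪fderiv ℝ (a i) x (Y x), Y x⟫_ℝ := by
  have hYx : HasFDerivAt Y (fderiv ℝ Y x) x :=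
    (hY.1.self_of_nhds.differentiableAt (by simp)).hasFDerivAt
  have hax : HasFDerivAt (a i) (fderiv ℝ (a i) x) x :=
    ((h.contDiff_gradient i).differentiable (by simp) x).hasFDerivAt
  have h0 : ∀ᶠ y in 𝓝[{y | ∀ i, g i y = 0}] x, ⟪Y y, a i y⟫_ℝ = 0 := by
    filter_upwards [hY.2, self_mem_nhdsWithin] with y hy hyM
    rw [real_inner_comm]
    exact (h.mem_tangentSpaceAt_iff hyM).1 hy i
  have hYT : Y x ∈ tangentSpaceAt {y | ∀ i, g i y = 0} x := hY.2.self_of_nhdsWithin hx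
  have := apply_eq_zero_of_mem_tangentSpaceAt (hYx.inner ℝ hax) h0 hYT
  simp only [ContinuousLinearMap.comp_apply, ContinuousLinearMap.prod_apply,
    fderivInnerCLM_apply] at this
  rw [real_inner_comm (Y x) (fderiv ℝ (a i) x (Y x))]
  linarith

/-- Subtract from the constant field `w` its components along the `a i y`. The result is smooth near
`x`, where these are nonzero, and tangent at points of the level set, where they are orthogonal. -/
theorem exists_isTangentFieldNear (h : IsOrthogonalSystem g a) {x : E} (hx : ∀ i, g i x = 0)
    {w : E} (hw : w ∈ tangentSpaceAt {y | ∀ i, g i y = 0} x) :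
    ∃ Y : E → E, IsTangentFieldNear {y | ∀ i, g i y = 0} x Y ∧ Y x = w := by
  rw [h.mem_tangentSpaceAt_iff hx] at hw
  refine ⟨fun y => w - ∑ i, (⟪a i y, w⟫_ℝ / ⟪a i y, a i y⟫_ℝ) • a i y, ⟨?_, ?_⟩, by simp [hw]⟩
  · have hne : ∀ᶠ y in 𝓝 x, ∀ i, a i y ≠ 0 := eventually_all.2 fun i =>
      (h.contDiff_gradient i).continuous.continuousAt.eventually_ne (h.ne_zero x hx i)
    filter_upwards [hne] with y hy
    refine contDiffAt_const.sub (ContDiffAt.sum fun i _ => ?_)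
    have ha := (h.contDiff_gradient i).contDiffAt (x := y)
    exact ((ha.inner ℝ contDiffAt_const).div (ha.inner ℝ ha) (inner_self_ne_zero.2 (hy i))).smul ha
  · filter_upwards [self_mem_nhdsWithin] with y hy
    refine (h.mem_tangentSpaceAt_iff hy).2 fun i => ?_
    rw [inner_sub_right, inner_sum, Finset.sum_eq_single i
      (fun j _ hj => by rw [inner_smul_right, h.inner_eq_zero y hy hj.symm, mul_zero]) (by simp),
      inner_smul_right, div_mul_cancel₀ _ (inner_self_ne_zero.2 (h.ne_zero y hy i)), sub_self]

theorem mem_normalSpaceAt (h : IsOrthogonalSystem g a) (s : Set ι) {x u : E}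
    (hx : ∀ i, g i x = 0)
    (hu : u ∈ normalSpaceAt {y | ∀ i, g i y = 0} {y | ∀ i ∈ s, g i y = 0} x) :
    ∃ c : ι → ℝ, (∀ i ∈ s, c i = 0) ∧ u = ∑ i, c i • a i x := by
  obtain ⟨h1, h2⟩ := Submodule.mem_inf.1 hu
  rw [h.tangentSpaceAt_eq' hx, Submodule.orthogonal_orthogonal] at h1
  rw [h.tangentSpaceAt_eq s hx, mem_orthogonal_span_image_iff] at h2
  obtain ⟨c, rfl⟩ := (Submodule.mem_span_range_iff_exists_fun ℝ).1 h1
  refine ⟨c, fun i hi => ?_, rfl⟩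
  have := h2 i hi
  rw [inner_sum, Finset.sum_eq_single i
      (fun j _ hj => by rw [inner_smul_right, h.inner_eq_zero x hx hj.symm, mul_zero]) (by simp),
      inner_smul_right] at this
  simpa [h.ne_zero x hx i] using this

/-- By `htr`, the normal directions account for the entire trace of the Hessian of `g j`, so its
trace over the tangent space is zero for every `j ∉ s`. Those `a j x` span the relevant normal
space. -/
theorem eq_zero_of_isMeanCurvatureVectorAt (h : IsOrthogonalSystem g a) (s : Set ι) {x H : E}
    (hx : ∀ i, g i x = 0)
    (htr : ∀ j ∉ s, LinearMap.trace ℝ E (fderiv ℝ (a j) x) =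
      ∑ i, ⟪fderiv ℝ (a j) x (a i x), a i x⟫_ℝ / ‖a i x‖ ^ 2)
    (hH : IsMeanCurvatureVectorAt {y | ∀ i, g i y = 0} {y | ∀ i ∈ s, g i y = 0} x H) :
    H = 0 := by
  obtain ⟨d, e, he, hon, hspan, rfl⟩ := hH
  set M : Set E := {y | ∀ i, g i y = 0}
  set N : Set E := {y | ∀ i ∈ s, g i y = 0}
  rw [h.tangentSpaceAt_eq' hx] at hspan
  have hnormal : ∀ j ∉ s, ∑ k, ⟪fderiv ℝ (e k) x (e k x), a j x⟫_ℝ = 0 := fun j hj => by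
    have := trace_eq_sum_inner_add_sum_inner hon (h.inner_eq_zero x hx) (h.ne_zero x hx) hspan
      (fderiv ℝ (a j) x)
    rw [htr j hj, right_eq_add] at this
    simp only [h.inner_fderiv_of_isTangentFieldNear hx (he _) j, Finset.sum_neg_distrib, this,
      neg_zero]
  set H := ∑ k, (normalSpaceAt M N x).starProjection (leviCivita N (e k) (e k) x)
  have hHmem : H ∈ normalSpaceAt M N x :=
    Submodule.sum_mem _ fun k _ => Submodule.starProjection_apply_mem _ _
  -- Since `H` is normal, pairing with `H` itself removes both orthogonal projections by
  -- self-adjointness.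
  refine inner_self_eq_zero (𝕜 := ℝ).1 ?_
  obtain ⟨c, hc, hcH⟩ := h.mem_normalSpaceAt s hx hHmem
  calc ⟪H, H⟫_ℝ = ∑ k, ⟪fderiv ℝ (e k) x (e k x), H⟫_ℝ := by
        conv_lhs => rw [show H = ∑ k, (normalSpaceAt M N x).starProjection
          (leviCivita N (e k) (e k) x) from rfl, sum_inner]
        refine Finset.sum_congr rfl fun k _ => ?_
        change ⟪_, H⟫_ℝ = _
        rw [Submodule.inner_starProjection_left_eq_right,
          Submodule.starProjection_eq_self_iff.2 hHmem, leviCivita,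
          Submodule.inner_starProjection_left_eq_right,
          Submodule.starProjection_eq_self_iff.2 hHmem.2]
    _ = ∑ k, ∑ i, c i * ⟪fderiv ℝ (e k) x (e k x), a i x⟫_ℝ := by
        simp only [hcH, inner_sum, inner_smul_right]
    _ = ∑ i, c i * ∑ k, ⟪fderiv ℝ (e k) x (e k x), a i x⟫_ℝ := by
        rw [Finset.sum_comm]; simp only [Finset.mul_sum]
    _ = 0 := Finset.sum_eq_zero fun i _ => by
        by_cases hi : i ∈ s
        · rw [hc i hi, zero_mul]
        · rw [hnormal i hi, mul_zero]

/-- For the converse direction some mean curvature vector must exist: extend an orthonormal basis of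
the tangent space to tangent fields; the resulting vector is then necessarily zero. -/
theorem isMinimalIn (h : IsOrthogonalSystem g a) (s : Set ι)
    (htr : ∀ x, (∀ i, g i x = 0) → ∀ j ∉ s, LinearMap.trace ℝ E (fderiv ℝ (a j) x) =
      ∑ i, ⟪fderiv ℝ (a j) x (a i x), a i x⟫_ℝ / ‖a i x‖ ^ 2) :
    IsMinimalIn {y | ∀ i, g i y = 0} {y | ∀ i ∈ s, g i y = 0} := by
  refine fun x hx H => ⟨h.eq_zero_of_isMeanCurvatureVectorAt s hx (htr x hx), ?_⟩
  rintro rfl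
  set b := stdOrthonormalBasis ℝ (tangentSpaceAt {y | ∀ i, g i y = 0} x)
  choose e he hex using fun k => h.exists_isTangentFieldNear hx (b k).2
  obtain ⟨H, hmean⟩ : ∃ H,
      IsMeanCurvatureVectorAt {y | ∀ i, g i y = 0} {y | ∀ i ∈ s, g i y = 0} x H := by
    refine ⟨_, _, e, he, ?_, ?_, rfl⟩
    · simp only [hex]
      exact b.orthonormal.comp_linearIsometry (Submodule.subtypeₗᵢ _)
    · simp only [hex]
      exact b.span_range_coe
  rwa [h.eq_zero_of_isMeanCurvatureVectorAt s hx (htr x hx) hmean] at hmean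

end IsOrthogonalSystem

end MeanCurvature

/-! ### Algebra of quadratic harmonic morphisms -/

section QuadraticHarmonicMorphisms

variable {E F : Type*} [NormedAddCommGroup E] [InnerProductSpace ℝ E]
  [NormedAddCommGroup F] [InnerProductSpace ℝ F]

/-- The components `⟨P, v⟩` of `P` are the quadratic forms of the symmetric operators `A v`. -/
structure IsRepresentedBy (P : E → F) (A : F →ₗ[ℝ] E →L[ℝ] E) : Prop where
  symm : ∀ v x y, ⟪A v x, y⟫_ℝ = ⟪x, A v y⟫_ℝ
  inner_eq : ∀ x v, ⟪P x, v⟫_ℝ = ⟪A v x, x⟫_ℝ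

namespace IsRepresentedBy

variable {P : E → F} {A : F →ₗ[ℝ] E →L[ℝ] E}

theorem hasFDerivAt_inner (h : IsRepresentedBy P A) (v : F) (x : E) :
    HasFDerivAt (fun y => ⟪P y, v⟫_ℝ) ((2 : ℝ) • innerSL ℝ (A v x)) x := by
  simp only [h.inner_eq]
  exact hasFDerivAt_inner_self (h.symm v) x

theorem gradient_inner [FiniteDimensional ℝ E] (h : IsRepresentedBy P A) (x : E) (v : F) :
    gradient (fun y => ⟪P y, v⟫_ℝ) x = (2 : ℝ) • A v x := by
  refine HasGradientAt.gradient ((h.hasFDerivAt_inner v x).congr_fderiv ?_)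
  ext w
  simp

variable [FiniteDimensional ℝ F]

theorem differentiable (h : IsRepresentedBy P A) : Differentiable ℝ P := by
  have hP : P = fun x => ∑ l, ⟪P x, stdOrthonormalBasis ℝ F l⟫_ℝ • stdOrthonormalBasis ℝ F l :=
    funext fun x => by
      simpa [real_inner_comm] using ((stdOrthonormalBasis ℝ F).sum_repr' (P x)).symm
  rw [hP]
  exact Differentiable.fun_sum fun l _ => Differentiable.smul_const
    (fun x => (h.hasFDerivAt_inner _ x).differentiableAt) _

theorem inner_fderiv (h : IsRepresentedBy P A) (x w : E) (v : F) :
    ⟪fderiv ℝ P x w, v⟫_ℝ = 2 * ⟪A v x, w⟫_ℝ := by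
  have h1 := (h.differentiable x).hasFDerivAt.inner ℝ (hasFDerivAt_const v x)
  simpa using congrArg (fun f => f w) (h1.unique (h.hasFDerivAt_inner v x))

variable [FiniteDimensional ℝ E]

theorem adjoint_fderiv (h : IsRepresentedBy P A) (x : E) (v : F) :
    ContinuousLinearMap.adjoint (fderiv ℝ P x) v = (2 : ℝ) • A v x := by
  refine ext_inner_right ℝ fun w => ?_
  rw [ContinuousLinearMap.adjoint_inner_left, real_inner_comm, h.inner_fderiv]
  simp [inner_smul_left]

theorem trace_eq_zero (h : IsRepresentedBy P A) (hharm : IsHarmonicMorphism P) (v : F) :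
    LinearMap.trace ℝ E (A v) = 0 := by
  have h1 := (hharm univ _ isOpen_univ (harmonicOnNhd_inner v univ) 0 trivial).2.self_of_nhds
  simp only [Function.comp_def, h.inner_eq, laplacian_inner_self (h.symm v), Pi.zero_apply] at h1
  linarith

theorem inner_eq_zero (h : IsRepresentedBy P A) (hharm : IsHarmonicMorphism P) {v w : F}
    (hvw : ⟪v, w⟫_ℝ = 0) (x : E) : ⟪A v x, A w x⟫_ℝ = 0 := by
  have h1 := (hharm univ _ isOpen_univ (harmonicOnNhd_inner_mul_inner hvw univ) x
    trivial).2.self_of_nhds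
  have hc : ∀ v, ContDiff ℝ 2 fun y => ⟪A v y, y⟫_ℝ := fun v =>
    (A v).contDiff.inner ℝ contDiff_id
  simp only [Function.comp_def, h.inner_eq, Pi.zero_apply] at h1
  rw [laplacian_mul (hc v) (hc w) (stdOrthonormalBasis ℝ E), laplacian_inner_self (h.symm v),
    laplacian_inner_self (h.symm w), h.trace_eq_zero hharm, h.trace_eq_zero hharm] at h1
  simp only [(hasFDerivAt_inner_self (h.symm _) x).fderiv] at h1
  have h2 := (stdOrthonormalBasis ℝ E).sum_inner_mul_inner (A v x) (A w x)
  rw [← h2]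
  simp only [smul_apply, innerSL_apply_apply, smul_eq_mul, mul_mul_mul_comm,
    ← Finset.mul_sum] at h1
  simpa [real_inner_comm] using h1

theorem inner_add_inner_eq_zero (h : IsRepresentedBy P A) (hharm : IsHarmonicMorphism P) {v w : F}
    (hvw : ⟪v, w⟫_ℝ = 0) (x y : E) : ⟪A v x, A w y⟫_ℝ + ⟪A v y, A w x⟫_ℝ = 0 := by
  have h1 := h.inner_eq_zero hharm hvw (x + y)
  simp only [map_add, inner_add_left, inner_add_right, h.inner_eq_zero hharm hvw] at h1
  linarith

/-- Equal norms make `v + w` and `v - w` orthogonal; apply the polarized relation to this pair. -/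
theorem inner_eq_inner (h : IsRepresentedBy P A) (hharm : IsHarmonicMorphism P) {v w : F}
    (hvw : ‖v‖ = ‖w‖) (x y : E) : ⟪A v x, A v y⟫_ℝ = ⟪A w x, A w y⟫_ℝ := by
  have h0 : ⟪v + w, v - w⟫_ℝ = 0 := by
    simp [inner_add_left, inner_sub_right, hvw, real_inner_comm, add_comm]
  have h1 := h.inner_add_inner_eq_zero hharm h0 x y
  simp only [map_add, map_sub, add_apply, sub_apply,
    inner_add_left, inner_sub_right] at h1
  rw [real_inner_comm (A v x) (A v y), real_inner_comm (A w x) (A w y),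
    real_inner_comm (A w x) (A v y), real_inner_comm (A v x) (A w y)] at h1
  linarith

theorem apply_apply_eq (h : IsRepresentedBy P A) (hharm : IsHarmonicMorphism P) {v w : F}
    (hvw : ‖v‖ = ‖w‖) (x : E) : A v (A v x) = A w (A w x) :=
  ext_inner_right ℝ fun y => by
    rw [h.symm v, h.symm w, h.inner_eq_inner hharm hvw]

theorem diffNormSq_eq (h : IsRepresentedBy P A) (hharm : IsHarmonicMorphism P) {v : F}
    (hv : ‖v‖ = 1) (x : E) :
    diffNormSq P x = 4 * Module.finrank ℝ F * ⟪A v (A v x), x⟫_ℝ := by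
  -- Cycling the trace moves it to `F`, where all basis vectors contribute equally.
  have h1 : diffNormSq P x = LinearMap.trace ℝ F
      ((fderiv ℝ P x).toLinearMap ∘ₗ
        (ContinuousLinearMap.adjoint (fderiv ℝ P x)).toLinearMap) :=
    LinearMap.trace_comp_comm' _ _
  have h2 : ∀ l, ⟪A (stdOrthonormalBasis ℝ F l) x, A (stdOrthonormalBasis ℝ F l) x⟫_ℝ =
      ⟪A v (A v x), x⟫_ℝ := fun l => by
    rw [h.symm v, h.inner_eq_inner hharm (w := v) (by simp [hv])]
  rw [h1, LinearMap.trace_eq_sum_inner _ (stdOrthonormalBasis ℝ F)]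
  simp only [LinearMap.comp_apply, ContinuousLinearMap.coe_coe, h.adjoint_fderiv]
  simp only [real_inner_comm (fderiv ℝ P x _), h.inner_fderiv, inner_smul_right, h2]
  simp
  ring

theorem gradient_diffNormSq (h : IsRepresentedBy P A) (hharm : IsHarmonicMorphism P) {v : F}
    (hv : ‖v‖ = 1) (x : E) :
    gradient (diffNormSq P) x = (8 * Module.finrank ℝ F : ℝ) • A v (A v x) := by
  rw [funext (h.diffNormSq_eq hharm hv)]
  have h1 : HasFDerivAt (fun y => ⟪A v (A v y), y⟫_ℝ) ((2 : ℝ) • innerSL ℝ (A v (A v x))) x :=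
    hasFDerivAt_inner_self (A := A v ∘L A v) (fun x y => by simp [h.symm]) x
  refine HasGradientAt.gradient ((h1.const_mul _).congr_fderiv ?_)
  ext w
  simp
  ring

/-- Pair the umbilic equation with `v`: the left side is a nonzero multiple of `⟨A v x, (A v)² x⟩`,
the right side is `η x * ⟨P x, v⟩ = 0`. -/
theorem inner_apply_apply_eq_zero (h : IsRepresentedBy P A) (hharm : IsHarmonicMorphism P)
    (humb : IsUmbilic P) {v : F} (hv : ‖v‖ = 1) {x : E} (hx : ⟪P x, v⟫_ℝ = 0) :
    ⟪A v x, A v (A v x)⟫_ℝ = 0 := by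
  obtain ⟨η, hη⟩ := humb
  have h1 := congrArg (fun u => ⟪u, v⟫_ℝ) (hη x)
  simp only [h.gradient_diffNormSq hharm hv, h.inner_fderiv, inner_smul_left, inner_smul_right,
    hx, mul_zero] at h1
  have : Nontrivial F := nontrivial_of_ne v 0 fun h0 => by simp [h0] at hv
  have : (Module.finrank ℝ F : ℝ) ≠ 0 := by
    exact_mod_cast (Module.finrank_pos (R := ℝ) (M := F)).ne'
  simpa [this] using h1

/-- If `A v x = 0`, then every `A w x` vanishes, since its norm depends only on `‖w‖` and `x`. By
symmetry `x` is orthogonal to all gradients `2 A w y`, contradicting fullness. -/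
theorem apply_ne_zero (h : IsRepresentedBy P A) (hharm : IsHarmonicMorphism P)
    (hfull : IsFullMap P) {v : F} (hv : ‖v‖ = 1) {x : E} (hx : x ≠ 0) : A v x ≠ 0 := by
  intro h0
  have h1 : ∀ w, A w x = 0 := fun w => by
    have h2 := h.inner_eq_inner hharm (v := w) (w := ‖w‖ • v) (by simp [norm_smul, hv]) x x
    simpa [h0] using h2
  refine hx (inner_self_eq_zero (𝕜 := ℝ).1 ?_)
  have h2 : x ∈ Submodule.span ℝ {w : E | ∃ (x : E) (v : F),
      w = gradient (fun y => inner ℝ (P y) v) x} := by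
    rw [show Submodule.span ℝ _ = ⊤ from hfull]
    trivial
  suffices h3 : ∀ u ∈ Submodule.span ℝ {w : E | ∃ (x : E) (v : F),
      w = gradient (fun y => inner ℝ (P y) v) x}, ⟪u, x⟫_ℝ = 0 from h3 x h2
  intro u hu
  induction hu using Submodule.span_induction with
  | mem u hu =>
    obtain ⟨y, w, rfl⟩ := hu
    rw [h.gradient_inner, inner_smul_left, h.symm, h1, inner_zero_right, mul_zero]
  | zero => simp
  | add u v _ _ hu hv => rw [inner_add_left, hu, hv, add_zero]
  | smul c u _ hu => rw [inner_smul_left, hu, mul_zero]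

theorem inner_apply_apply_apply_eq_zero (h : IsRepresentedBy P A) (hharm : IsHarmonicMorphism P)
    (humb : IsUmbilic P) {ι : Type*} {v : ι → F} (hv : Orthonormal ℝ v) {x : E}
    (hx : ∀ j, ⟪P x, v j⟫_ℝ = 0) (j l : ι) :
    ⟪A (v j) (A (v l) x), A (v l) x⟫_ℝ = 0 := by
  have h0 := h.inner_apply_apply_eq_zero hharm humb (hv.1 j) (hx j)
  by_cases hjl : j = l
  · subst hjl
    rwa [real_inner_comm]
  -- Anticommuting and replacing `(A (v l))²` by `(A (v j))²` reduces the mixed term to the case `j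
  -- = l`.
  · have h1 := h.inner_add_inner_eq_zero hharm (hv.2 hjl) x (A (v l) x)
    rw [h.apply_apply_eq hharm ((hv.1 l).trans (hv.1 j).symm), h0, zero_add] at h1
    exact h1

/-- The functions `‖x‖² - 1` and `⟨P, v j⟩`. -/
def definingFunctions {ι : Type*} (A : F →ₗ[ℝ] E →L[ℝ] E) (v : ι → F) : Option ι → E → ℝ
  | none, x => ⟪x, x⟫_ℝ - 1
  | some j, x => ⟪A (v j) x, x⟫_ℝ

/-- The gradients of `definingFunctions A v`. -/
def definingGradients {ι : Type*} (A : F →ₗ[ℝ] E →L[ℝ] E) (v : ι → F) : Option ι → E → E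
  | none, x => (2 : ℝ) • x
  | some j, x => (2 : ℝ) • A (v j) x

theorem isOrthogonalSystem (h : IsRepresentedBy P A) (hharm : IsHarmonicMorphism P)
    (hfull : IsFullMap P) {ι : Type*} {v : ι → F} (hv : Orthonormal ℝ v) :
    IsOrthogonalSystem (definingFunctions A v) (definingGradients A v) where
  contDiff
    | none => (contDiff_id.inner ℝ contDiff_id).sub contDiff_const
    | some j => (A (v j)).contDiff.inner ℝ contDiff_id
  contDiff_gradient
    | none => contDiff_id.const_smul (2 : ℝ)
    | some j => (A (v j)).contDiff.const_smul (2 : ℝ)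
  hasFDerivAt
    | none, y => by
      have := hasFDerivAt_inner_self (A := ContinuousLinearMap.id ℝ E) (fun _ _ => rfl) y
      refine (this.sub_const 1).congr_fderiv ?_
      simp [definingGradients]
    | some j, y => (hasFDerivAt_inner_self (h.symm (v j)) y).congr_fderiv
        (by simp [definingGradients])
  inner_eq_zero y hy i j hij := by
    have hy' : ∀ j, ⟪A (v j) y, y⟫_ℝ = 0 := fun j => hy (some j)
    match i, j with
    | none, none => exact absurd rfl hij
    | none, some j =>
      simp [definingGradients, inner_smul_left, inner_smul_right, ← h.symm, hy']
    | some j, none => simp [definingGradients, inner_smul_left, inner_smul_right, hy']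
    | some i, some j =>
      have : i ≠ j := fun h => hij (h ▸ rfl)
      simp [definingGradients, inner_smul_left, inner_smul_right,
        h.inner_eq_zero hharm (hv.2 this)]
  ne_zero y hy i := by
    have hy0 : y ≠ 0 := fun h0 => by simpa [definingFunctions, h0] using hy none
    match i with
    | none => exact smul_ne_zero two_ne_zero hy0
    | some j => exact smul_ne_zero two_ne_zero (h.apply_ne_zero hharm hfull (hv.1 j) hy0)

theorem trace_fderiv_definingGradients (h : IsRepresentedBy P A) (hharm : IsHarmonicMorphism P)
    (humb : IsUmbilic P) {ι : Type*} [Fintype ι] {v : ι → F} (hv : Orthonormal ℝ v) {x : E}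
    (hx : ∀ i, definingFunctions A v i x = 0) (j : ι) :
    LinearMap.trace ℝ E (fderiv ℝ (definingGradients A v (some j)) x) =
      ∑ i, ⟪fderiv ℝ (definingGradients A v (some j)) x (definingGradients A v i x),
        definingGradients A v i x⟫_ℝ / ‖definingGradients A v i x‖ ^ 2 := by
  have hx' : ∀ j, ⟪A (v j) x, x⟫_ℝ = 0 := fun j => hx (some j)
  have hd : fderiv ℝ (definingGradients A v (some j)) x = (2 : ℝ) • A (v j) :=
    ((A (v j)).hasFDerivAt.const_smul (2 : ℝ)).fderiv
  have h0 := h.inner_apply_apply_apply_eq_zero hharm humb hv (x := x)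
    (fun l => (h.inner_eq x (v l)).trans (hx' l)) j
  rw [hd, Fintype.sum_option]
  simp [definingGradients, inner_smul_left, inner_smul_right, h0, hx', h.trace_eq_zero hharm]

end IsRepresentedBy

end QuadraticHarmonicMorphisms

/-! ### The main theorem -/

theorem mainTheorem8 (m n k : ℕ)
    (P : EuclideanSpace ℝ (Fin m) → EuclideanSpace ℝ (Fin n))
    (hquad : IsQuadraticMap P) (hharm : IsHarmonicMorphism P)
    (humb : IsUmbilic P) (hfull : IsFullMap P)
    (V : Submodule ℝ (EuclideanSpace ℝ (Fin n))) (hV : Module.finrank ℝ V = k) :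
    IsCompact (P ⁻¹' V ∩ Metric.sphere (0 : EuclideanSpace ℝ (Fin m)) 1) ∧
    IsSubmanifoldOfCodim (P ⁻¹' V ∩ Metric.sphere (0 : EuclideanSpace ℝ (Fin m)) 1)
      (Metric.sphere (0 : EuclideanSpace ℝ (Fin m)) 1) (n - k) ∧
    IsMinimalIn (P ⁻¹' V ∩ Metric.sphere (0 : EuclideanSpace ℝ (Fin m)) 1)
      (Metric.sphere (0 : EuclideanSpace ℝ (Fin m)) 1) := by
  obtain ⟨A, hA, hPA⟩ := hquad.exists_inner_eq
  have h : IsRepresentedBy P A := ⟨hA, hPA⟩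
  refine ⟨(isCompact_sphere _ _).inter_left
    (V.closed_of_finiteDimensional.preimage h.differentiable.continuous), ?_⟩
  set b := stdOrthonormalBasis ℝ Vᗮ
  set v : Fin (Module.finrank ℝ Vᗮ) → EuclideanSpace ℝ (Fin n) := fun j => b j
  have hv : Orthonormal ℝ v := b.orthonormal.comp_linearIsometry (Submodule.subtypeₗᵢ _)
  have hvspan : Submodule.span ℝ (v '' univ) = Vᗮ := by
    rw [image_univ]
    exact b.span_range_coe
  have hmem : ∀ y, P y ∈ V ↔ ∀ j, ⟪A (v j) y, y⟫_ℝ = 0 := fun y => by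
    have h1 : P y ∈ V ↔ P y ∈ (Submodule.span ℝ (v '' univ))ᗮ := by
      rw [hvspan, V.orthogonal_orthogonal]
    rw [h1, mem_orthogonal_span_image_iff]
    simp [real_inner_comm (P y), ← hPA]
  have hsphere : ∀ y : EuclideanSpace ℝ (Fin m), y ∈ Metric.sphere 0 1 ↔
      IsRepresentedBy.definingFunctions A v none y = 0 := fun y => by
    rw [mem_sphere_zero_iff_norm, IsRepresentedBy.definingFunctions, real_inner_self_eq_norm_sq,
      sub_eq_zero, pow_eq_one_iff_of_nonneg (norm_nonneg y) two_ne_zero]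
  have hN : Metric.sphere (0 : EuclideanSpace ℝ (Fin m)) 1 =
      {y | ∀ i ∈ ({none} : Finset (Option _)), IsRepresentedBy.definingFunctions A v i y = 0} := by
    ext y
    rw [hsphere]
    simp
  have hM : P ⁻¹' V ∩ Metric.sphere (0 : EuclideanSpace ℝ (Fin m)) 1 =
      {y | ∀ i, IsRepresentedBy.definingFunctions A v i y = 0} := by
    ext y
    simp only [mem_inter_iff, mem_preimage, SetLike.mem_coe, hmem, hsphere, mem_ofPred_eq,
      Option.forall]
    exact and_comm
  have hsys := h.isOrthogonalSystem hharm hfull hv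
  -- The index `none` is the sphere's own equation, so it does not count towards the codimension in
  -- the sphere.
  have hcodim : n - k = Fintype.card (Option (Fin (Module.finrank ℝ Vᗮ))) -
      ({none} : Finset (Option (Fin (Module.finrank ℝ Vᗮ)))).card := by
    have := V.finrank_add_finrank_orthogonal
    rw [finrank_euclideanSpace_fin, hV] at this
    simp
    omega
  rw [hM, hN, hcodim]
  refine ⟨hsys.isSubmanifoldOfCodim _, hsys.isMinimalIn _ fun x hx j hj => ?_⟩
  match j with
  | none => simp at hj
  | some j => exact h.trace_fderiv_definingGradients hharm humb hv hx j
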